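/- Let $R$ be a commutative ring (for instance the centre of a connected artin algebra) and let $(\mathcal{A},\mathbb{E},\mathfrak{s})$ be an $R$-linear extriangulated category in the sense of Nakaoka–Palu; that is, $\mathcal{A}$ is an $R$-linear additive category and $\mathbb{E}:\mathcal{A}^{\mathrm{op}}\times\mathcal{A}\to\mathrm{Mod}\,R$ is an $R$-bilinear functor. Assume that $\mathcal{A}$ is Krull–Schmidt, i.e. every object is a finite direct sum of objects with local endomorphism rings, and that $\mathcal{A}$ is $R$-finite, i.e. $\operatorname{Hom}_{\mathcal{A}}(A,B)$ and $\mathbb{E}(A,B)$ are $R$-modules of finite length for all $A,B\in\mathcal{A}$. Let $\mathcal{X}$ be a finite semibrick in $\mathcal{A}$: a finite set of isomorphism classes of objects whose endomorphism rings are division rings, such that $\operatorname{Hom}_{\mathcal{A}}(X_1,X_2)=0$ for any two non-isomorphic $X_1,X_2\in\mathcal{X}$. Let $\operatorname{Filt}_{\mathcal{A}}(\mathcal{X})$ be the full subcategory of all objects $M$ admitting a finite filtration $0=M_0\xrightarrow{f_0}M_1\xrightarrow{f_1}\cdots\xrightarrow{f_{n-1}}M_n=M$ in which every $f_i$ is an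 inflation with $\operatorname{cone}(f_i)\in\mathcal{X}$, and let $l_{\mathcal{X}}(M)$ be the minimal length $n$ of such a filtration. Let $\operatorname{ind}(\operatorname{Filt}_{\mathcal{A}}(\mathcal{X}))$ be the set of isomorphism classes of indecomposable objects of $\operatorname{Filt}_{\mathcal{A}}(\mathcal{X})$. Then the following conditions are equivalent: (1) $|\operatorname{ind}(\operatorname{Filt}_{\mathcal{A}}(\mathcal{X}))|<\infty$. (2) The set $\{\,l_{\mathcal{X}}(M)\mid M\in\operatorname{ind}(\operatorname{Filt}_{\mathcal{A}}(\mathcal{X}))\,\}$ has an upper bound. -/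

import Mathlib

open CategoryTheory CategoryTheory.Limits Opposite

universe w v u

namespace Extri

/-! ### Extensions and sequences -/

section Basic

variable {C : Type u} [Category.{v} C]

/-- The abelian group `𝔼(Z, X)` of extensions, for a bifunctor `𝔼 : Cᵒᵖ × C → Ab`. -/
abbrev Ext (E : Cᵒᵖ ⥤ C ⥤ AddCommGrpCat.{w}) (Z X : C) : Type w :=
  (E.obj (op Z)).obj X

/-- `push E a δ` is `a_* δ = 𝔼(Z, a)(δ)`. -/
abbrev push (E : Cᵒᵖ ⥤ C ⥤ AddCommGrpCat.{w}) {Z X X' : C} (a : X ⟶ X') (δ : Ext E Z X) :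
    Ext E Z X' :=
  ((E.obj (op Z)).map a).hom δ

/-- `pull E c δ` is `c^* δ = 𝔼(c, X)(δ)`. -/
abbrev pull (E : Cᵒᵖ ⥤ C ⥤ AddCommGrpCat.{w}) {Z Z' X : C} (c : Z' ⟶ Z) (δ : Ext E Z X) :
    Ext E Z' X :=
  ((E.map c.op).app X).hom δ

/-- A sequence `X ⟶ Y ⟶ Z` with prescribed ends. -/
structure Seq (X Z : C) where
  mid : C
  fst : X ⟶ mid
  snd : mid ⟶ Z

/-- Two sequences with the same ends are equivalent if there is an isomorphism between the middle
terms which is compatible with the identities of the ends. -/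
def Seq.setoid (X Z : C) : Setoid (Seq X Z) where
  r S T := ∃ b : S.mid ≅ T.mid, S.fst ≫ b.hom = T.fst ∧ b.hom ≫ T.snd = S.snd
  iseqv :=
    { refl := fun S => ⟨Iso.refl _, by simp, by simp⟩
      symm := by
        rintro S T ⟨b, h₁, h₂⟩
        exact ⟨b.symm, by simp [← h₁], by simp [← h₂]⟩
      trans := by
        rintro S T U ⟨b, h₁, h₂⟩ ⟨b', h₁', h₂'⟩
        exact ⟨b ≪≫ b', by simp [← h₁', ← h₁], by simp [h₂', h₂]⟩ }

/-- Equivalence classes `[X ⟶ Y ⟶ Z]` of sequences. -/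
def SeqClass (X Z : C) : Type (max u v) := Quotient (Seq.setoid X Z)

/-- The class `[X ⟶ Y ⟶ Z]` of the sequence formed by `x` and `y`. -/
def SeqClass.mk {X Y Z : C} (x : X ⟶ Y) (y : Y ⟶ Z) : SeqClass X Z :=
  Quotient.mk (Seq.setoid X Z) ⟨Y, x, y⟩

/-- A correspondence which associates to every extension a class of sequences. -/
abbrev Correspondence (E : Cᵒᵖ ⥤ C ⥤ AddCommGrpCat.{w}) : Type (max u v w) :=
  ∀ ⦃X Z : C⦄, Ext E Z X → SeqClass X Z

/-- `X ⟶ Y ⟶ Z` realizes the extension `δ`; that is, it is an `𝔼`-triangle `X ⟶ Y ⟶ Z ⇢` with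
extension `δ`. -/
def Realizes {E : Cᵒᵖ ⥤ C ⥤ AddCommGrpCat.{w}} (s : Correspondence E) {X Y Z : C}
    (x : X ⟶ Y) (y : Y ⟶ Z) (δ : Ext E Z X) : Prop :=
  s δ = SeqClass.mk x y

/-- `X ⟶ Y ⟶ Z` is a conflation; then `x` is an inflation, `y` is a deflation and
`Z = cone(x)`. -/
def IsConflation {E : Cᵒᵖ ⥤ C ⥤ AddCommGrpCat.{w}} (s : Correspondence E) {X Y Z : C}
    (x : X ⟶ Y) (y : Y ⟶ Z) : Prop :=
  ∃ δ : Ext E Z X, Realizes s x y δ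

end Basic

/-! ### Extriangulated categories -/

section Extriangulated

variable {C : Type u} [Category.{v} C] [Preadditive C] [HasBinaryBiproducts C]

/-- The direct sum `δ ⊕ δ'` of two extensions: the element of `𝔼(Z ⊕ Z', X ⊕ X')` which corresponds
to `(δ, 0, 0, δ')` in `𝔼(Z, X) ⊕ 𝔼(Z, X') ⊕ 𝔼(Z', X) ⊕ 𝔼(Z', X')`. -/
noncomputable def extSum (E : Cᵒᵖ ⥤ C ⥤ AddCommGrpCat.{w}) {X Z X' Z' : C} (δ : Ext E Z X)
    (δ' : Ext E Z' X') : Ext E (Z ⊞ Z') (X ⊞ X') :=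
  push E (biprod.inl : X ⟶ X ⊞ X') (pull E (biprod.fst : Z ⊞ Z' ⟶ Z) δ) +
    push E (biprod.inr : X' ⟶ X ⊞ X') (pull E (biprod.snd : Z ⊞ Z' ⟶ Z') δ')

/-- `s` is an additive realization of `E`. -/
structure IsAdditiveRealization (E : Cᵒᵖ ⥤ C ⥤ AddCommGrpCat.{w}) (s : Correspondence E) :
    Prop where
  /-- Every morphism `(a, c) : δ ⟶ δ'` of extensions is realized by some triple `(a, b, c)`. -/
  exists_mid : ∀ {X Y Z X' Y' Z' : C} {x : X ⟶ Y} {y : Y ⟶ Z} {x' : X' ⟶ Y'} {y' : Y' ⟶ Z'}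
    {δ : Ext E Z X} {δ' : Ext E Z' X'}, Realizes s x y δ → Realizes s x' y' δ' →
    ∀ (a : X ⟶ X') (c : Z ⟶ Z'), push E a δ = pull E c δ' →
      ∃ b : Y ⟶ Y', x ≫ b = a ≫ x' ∧ y ≫ c = b ≫ y'
  /-- The split extension is realized by the split sequence. -/
  realizes_zero : ∀ X Z : C,
    Realizes s (biprod.inl : X ⟶ X ⊞ Z) (biprod.snd : X ⊞ Z ⟶ Z) (0 : Ext E Z X)
  realizes_sum : ∀ {X Y Z X' Y' Z' : C} {x : X ⟶ Y} {y : Y ⟶ Z} {x' : X' ⟶ Y'} {y' : Y' ⟶ Z'}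
    {δ : Ext E Z X} {δ' : Ext E Z' X'}, Realizes s x y δ → Realizes s x' y' δ' →
      Realizes s (biprod.map x x') (biprod.map y y') (extSum E δ δ')

/-- The triple `(C, E, s)` is an extriangulated category (Nakaoka–Palu). -/
structure IsExtriangulated (E : Cᵒᵖ ⥤ C ⥤ AddCommGrpCat.{w}) (s : Correspondence E) : Prop where
  /-- (ET1), additivity in the first variable -/
  additive_left : E.Additive
  /-- (ET1), additivity in the second variable -/
  additive_right : ∀ Z : Cᵒᵖ, (E.obj Z).Additive
  /-- (ET2) -/
  realization : IsAdditiveRealization E s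
  /-- (ET3) -/
  et3 : ∀ {X Y Z X' Y' Z' : C} {x : X ⟶ Y} {y : Y ⟶ Z} {x' : X' ⟶ Y'} {y' : Y' ⟶ Z'}
    {δ : Ext E Z X} {δ' : Ext E Z' X'}, Realizes s x y δ → Realizes s x' y' δ' →
    ∀ (a : X ⟶ X') (b : Y ⟶ Y'), x ≫ b = a ≫ x' →
      ∃ c : Z ⟶ Z', push E a δ = pull E c δ' ∧ y ≫ c = b ≫ y'
  /-- (ET3)ᵒᵖ -/
  et3_op : ∀ {X Y Z X' Y' Z' : C} {x : X ⟶ Y} {y : Y ⟶ Z} {x' : X' ⟶ Y'} {y' : Y' ⟶ Z'}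
    {δ : Ext E Z X} {δ' : Ext E Z' X'}, Realizes s x y δ → Realizes s x' y' δ' →
    ∀ (b : Y ⟶ Y') (c : Z ⟶ Z'), y ≫ c = b ≫ y' →
      ∃ a : X ⟶ X', push E a δ = pull E c δ' ∧ x ≫ b = a ≫ x'
  /-- (ET4) -/
  et4 : ∀ {A B D Y F : C} {f : A ⟶ B} {f' : B ⟶ D} {g : B ⟶ Y} {g' : Y ⟶ F}
    {δ : Ext E D A} {δ' : Ext E F B}, Realizes s f f' δ → Realizes s g g' δ' →
    ∃ (K : C) (h' : Y ⟶ K) (d : D ⟶ K) (e : K ⟶ F) (δ'' : Ext E K A),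
      f' ≫ d = g ≫ h' ∧ h' ≫ e = g' ∧ Realizes s (f ≫ g) h' δ'' ∧
      Realizes s d e (push E f' δ') ∧ pull E d δ'' = δ ∧ push E f δ'' = pull E e δ'
  /-- (ET4)ᵒᵖ -/
  et4_op : ∀ {D A B F Y : C} {f' : D ⟶ A} {f : A ⟶ B} {g' : F ⟶ B} {g : B ⟶ Y}
    {δ : Ext E B D} {δ' : Ext E Y F}, Realizes s f' f δ → Realizes s g' g δ' →
    ∃ (K : C) (h' : K ⟶ A) (d : D ⟶ K) (e : K ⟶ F) (δ'' : Ext E Y K),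
      h' ≫ f = e ≫ g' ∧ d ≫ h' = f' ∧ Realizes s h' (f ≫ g) δ'' ∧
      Realizes s d e (pull E g' δ) ∧ push E e δ'' = δ' ∧ push E d δ = pull E g δ''

/-- An `R`-linear structure on the extension groups of an `R`-linear category: `𝔼` takes values in
`R`-modules and is `R`-bilinear on morphisms. -/
class LinearExt (R : Type*) [CommRing R] [Linear R C] (E : Cᵒᵖ ⥤ C ⥤ AddCommGrpCat.{w}) where
  module : ∀ Z X : C, Module R (Ext E Z X)
  push_smul : ∀ {Z X X' : C} (a : X ⟶ X') (r : R) (δ : Ext E Z X),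
    push E a (r • δ) = r • push E a δ
  pull_smul : ∀ {Z Z' X : C} (c : Z' ⟶ Z) (r : R) (δ : Ext E Z X),
    pull E c (r • δ) = r • pull E c δ
  smul_push : ∀ {Z X X' : C} (r : R) (a : X ⟶ X') (δ : Ext E Z X),
    push E (r • a) δ = r • push E a δ
  smul_pull : ∀ {Z Z' X : C} (r : R) (c : Z' ⟶ Z) (δ : Ext E Z X),
    pull E (r • c) δ = r • pull E c δ

attribute [instance, reducible] LinearExt.module

/-- All morphism and extension modules have finite length over `R`. -/
structure IsRFinite (R : Type*) [CommRing R] [Linear R C] (E : Cᵒᵖ ⥤ C ⥤ AddCommGrpCat.{w})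
    [LinearExt R E] : Prop where
  hom : ∀ X Y : C, Module.length R (X ⟶ Y) < ⊤
  ext : ∀ Z X : C, Module.length R (Ext E Z X) < ⊤

end Extriangulated

/-! ### Isomorphism classes, indecomposable objects, Krull–Schmidt categories -/

/-- Isomorphism classes of objects. -/
abbrev IsoClasses (C : Type u) [Category.{v} C] : Type u := Quotient (isIsomorphicSetoid C)

/-- The isomorphism class of an object. -/
abbrev isoClass {C : Type u} [Category.{v} C] (M : C) : IsoClasses C :=
  Quotient.mk (isIsomorphicSetoid C) M

/-- `M` is nonzero, and in every decomposition `M ≅ Y ⊕ Z` one of `Y`, `Z` is zero. Biproducts are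
given by bicones, so that the category need not be known to have all of them. -/
def IsIndecomposable {C : Type u} [Category.{v} C] [HasZeroMorphisms C] (M : C) : Prop :=
  ¬ IsZero M ∧ ∀ (Y Z : C) (b : BinaryBicone Y Z), Nonempty b.IsBilimit → Nonempty (M ≅ b.pt) →
    IsZero Y ∨ IsZero Z

/-- `ind(C)`: the set of isomorphism classes of indecomposable objects of `C`. -/
def ind (C : Type u) [Category.{v} C] [HasZeroMorphisms C] : Set (IsoClasses C) :=
  {m | ∃ M : C, IsIndecomposable M ∧ isoClass M = m}

/-- Every object is a finite direct sum of objects with local endomorphism rings. -/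
def IsKrullSchmidt (C : Type u) [Category.{v} C] [Preadditive C] : Prop :=
  ∀ M : C, ∃ (n : ℕ) (F : Fin n → C) (b : Bicone F),
    (∀ i, IsLocalRing (End (F i))) ∧ Nonempty b.IsBilimit ∧ Nonempty (M ≅ b.pt)

/-! ### Semibricks and filtrations -/

section Filtrations

variable {C : Type u} [Category.{v} C]

/-- The endomorphism ring of `M` is a division ring. -/
def IsBrick [Preadditive C] (M : C) : Prop :=
  Nontrivial (End M) ∧ ∀ f : End M, f ≠ 0 → IsUnit f

/-- A set of isomorphism classes of bricks, with no nonzero morphisms between non-isomorphic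
members. -/
structure IsSemibrick [Preadditive C] (𝒳 : Set (IsoClasses C)) : Prop where
  brick : ∀ M : C, isoClass M ∈ 𝒳 → IsBrick M
  hom_eq_zero : ∀ M N : C, isoClass M ∈ 𝒳 → isoClass N ∈ 𝒳 → IsEmpty (M ≅ N) →
    ∀ f : M ⟶ N, f = 0

/-- `HasFiltration s 𝒳 n M`: there is a filtration `0 = M₀ ⟶ M₁ ⟶ ⋯ ⟶ Mₙ = M` of length `n` by
inflations whose cones belong to `𝒳`. -/
inductive HasFiltration {E : Cᵒᵖ ⥤ C ⥤ AddCommGrpCat.{w}} (s : Correspondence E)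
    (𝒳 : Set (IsoClasses C)) : ℕ → C → Prop
  | zero {M : C} : IsZero M → HasFiltration s 𝒳 0 M
  | succ {n : ℕ} {M N S : C} (f : M ⟶ N) (g : N ⟶ S) : HasFiltration s 𝒳 n M →
      IsConflation s f g → isoClass S ∈ 𝒳 → HasFiltration s 𝒳 (n + 1) N

/-- The filtration subcategory `Filt(𝒳)`, as a property of objects; the category itself is
`(Filt s 𝒳).FullSubcategory`. -/
def Filt {E : Cᵒᵖ ⥤ C ⥤ AddCommGrpCat.{w}} (s : Correspondence E) (𝒳 : Set (IsoClasses C)) :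
    ObjectProperty C :=
  fun M => ∃ n, HasFiltration s 𝒳 n M

/-- The `𝒳`-length of an object of `Filt(𝒳)`: the minimal length of an `𝒳`-filtration. -/
noncomputable def filtLength {E : Cᵒᵖ ⥤ C ⥤ AddCommGrpCat.{w}} (s : Correspondence E)
    (𝒳 : Set (IsoClasses C)) (M : (Filt s 𝒳).FullSubcategory) : ℕ :=
  sInf {n | HasFiltration s 𝒳 n M.obj}

end Filtrations

end Extri

/-! If there are finitely many indecomposables, then lengths are bounded because length is invariant
under isomorphism. The content is the converse, a version for `Filt(𝒳)` of the Harada–Sai and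
Auslander argument for artin algebras.

No kernels are available, so monomorphisms are replaced by socle-injective morphisms (`SocInj`),
those which kill no nonzero morphism from a member of `𝒳`. By Schur's lemma every nonzero `X ⟶ M`
with `X` in `𝒳` has a cone in `Filt(𝒳)` of length one less (`exists_cone_len`). Hence
socle-injective morphisms do not decrease length and are invertible when lengths agree
(`len_le_and_isIso`), while every other morphism factors through a shorter object. This makes
`Filt(𝒳)` idempotent complete, so its indecomposables are the atoms, the objects with only trivial
idempotents.

If atoms have length at most `n`, then a composite of `2 ^ n - 1` non-isomorphisms between atoms
vanishes (`eq_zero_of_radComp`). So non-invertible endomorphisms are nilpotent, and every atom is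
the source of a left almost split family (`exists_leftAlmostSplit`). Follow these finite families
from `𝒳` for `2 ^ n - 1` steps. If an atom `N` is not met, each morphism from `𝒳` to `N` is a sum of
vanishing composites, yet `N` receives a nonzero morphism from `𝒳` (`exists_finite_atoms`). -/

namespace Extri

/-! ### Functoriality of the actions on extensions -/

section Actions

variable {C : Type u} [Category.{v} C] {E : Cᵒᵖ ⥤ C ⥤ AddCommGrpCat.{w}}

lemma push_id {Z X : C} (δ : Ext E Z X) : push E (𝟙 X) δ = δ := by simp [push]

lemma pull_id {Z X : C} (δ : Ext E Z X) : pull E (𝟙 Z) δ = δ := by simp [pull]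

lemma push_comp {Z X X' X'' : C} (a : X ⟶ X') (b : X' ⟶ X'') (δ : Ext E Z X) :
    push E (a ≫ b) δ = push E b (push E a δ) := by simp [push]

lemma pull_comp {Z Z' Z'' X : C} (c : Z' ⟶ Z) (d : Z'' ⟶ Z') (δ : Ext E Z X) :
    pull E (d ≫ c) δ = pull E d (pull E c δ) := by simp [pull]

lemma push_zero {Z X X' : C} (a : X ⟶ X') : push E a (0 : Ext E Z X) = 0 := map_zero _

lemma pull_zero {Z Z' X : C} (c : Z' ⟶ Z) : pull E c (0 : Ext E Z X) = 0 := map_zero _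

end Actions

/-! ### Exact sequences and splitting for `𝔼`-triangles -/

section Exactness

variable {C : Type u} [Category.{v} C] [Preadditive C] [HasBinaryBiproducts C]
  {E : Cᵒᵖ ⥤ C ⥤ AddCommGrpCat.{w}} {s : Correspondence E}

lemma IsExtriangulated.pull_add (h : IsExtriangulated E s) {Z Z' X : C} (c d : Z' ⟶ Z)
    (δ : Ext E Z X) : pull E (c + d) δ = pull E c δ + pull E d δ := by
  have := h.additive_left
  simp [pull, Functor.map_add]

lemma IsExtriangulated.push_zero_left (h : IsExtriangulated E s) {Z X X' : C}
    (δ : Ext E Z X) : push E (0 : X ⟶ X') δ = 0 := by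
  have := h.additive_right (op Z)
  simp [push]

lemma IsExtriangulated.pull_zero_left (h : IsExtriangulated E s) {Z Z' X : C}
    (δ : Ext E Z X) : pull E (0 : Z' ⟶ Z) δ = 0 := by
  have := h.additive_left
  simp [pull]

lemma IsExtriangulated.pull_sum (h : IsExtriangulated E s) {Z Z' X : C} {ι : Type*}
    (t : Finset ι) (c : ι → (Z' ⟶ Z)) (δ : Ext E Z X) :
    pull E (∑ i ∈ t, c i) δ = ∑ i ∈ t, pull E (c i) δ := by
  classical
  induction t using Finset.induction_on with
  | empty => simpa using h.pull_zero_left δ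
  | insert i t hi ih => rw [Finset.sum_insert hi, Finset.sum_insert hi, h.pull_add, ih]

omit [Preadditive C] [HasBinaryBiproducts C] in
lemma exists_realizes (s : Correspondence E) {X Z : C} (δ : Ext E Z X) :
    ∃ (Y : C) (x : X ⟶ Y) (y : Y ⟶ Z), Realizes s x y δ := by
  obtain ⟨S, hS⟩ := Quotient.exists_rep (s δ)
  exact ⟨S.mid, S.fst, S.snd, hS.symm⟩

omit [Preadditive C] [HasBinaryBiproducts C] in
lemma Realizes.of_iso {X Y Y' Z : C} {x : X ⟶ Y} {y : Y ⟶ Z} {δ : Ext E Z X}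
    (hδ : Realizes s x y δ) (b : Y ≅ Y') {x' : X ⟶ Y'} {y' : Y' ⟶ Z} (hx : x ≫ b.hom = x')
    (hy : b.hom ≫ y' = y) : Realizes s x' y' δ := by
  unfold Realizes at *
  rw [hδ]
  exact Quotient.sound ⟨b, hx, hy⟩

namespace IsExtriangulated

variable (h : IsExtriangulated E s)

include h

variable {X Y Z : C} {x : X ⟶ Y} {y : Y ⟶ Z} {δ : Ext E Z X}

/-- A morphism which annihilates the extension extends along the inflation. -/
lemma exists_extend (hδ : Realizes s x y δ) {W : C} (a : X ⟶ W) (ha : push E a δ = 0) :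
    ∃ b : Y ⟶ W, x ≫ b = a := by
  obtain ⟨b, hb, -⟩ := h.realization.exists_mid hδ (h.realization.realizes_zero W Z) a (𝟙 Z)
    (by rw [ha, pull_zero])
  exact ⟨b ≫ biprod.fst, by rw [← Category.assoc, hb]; simp⟩

lemma exists_lift (hδ : Realizes s x y δ) {W : C} (c : W ⟶ Z) (hc : pull E c δ = 0) :
    ∃ b : W ⟶ Y, b ≫ y = c := by
  obtain ⟨b, -, hb⟩ := h.realization.exists_mid (h.realization.realizes_zero X W) hδ (𝟙 X) c
    (by rw [hc, push_zero])
  exact ⟨biprod.inr ≫ b, by rw [Category.assoc, ← hb]; simp⟩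

/-- The inflation has `y` as a weak cokernel: apply (ET3) to compare with the split triangle `W ⟶ W
⊞ W ⟶ W`. The dual lemma `exists_factor` uses (ET3)ᵒᵖ. -/
lemma exists_desc (hδ : Realizes s x y δ) {W : C} (f : Y ⟶ W) (hf : x ≫ f = 0) :
    ∃ g : Z ⟶ W, y ≫ g = f := by
  obtain ⟨c, -, hc⟩ := h.et3 hδ (h.realization.realizes_zero W W) (0 : X ⟶ W)
    (f ≫ biprod.inr) (by simp [reassoc_of% hf])
  exact ⟨c, by rw [hc]; simp⟩

lemma exists_factor (hδ : Realizes s x y δ) {W : C} (f : W ⟶ Y) (hf : f ≫ y = 0) :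
    ∃ g : W ⟶ X, g ≫ x = f := by
  obtain ⟨c, -, hc⟩ := h.et3_op (h.realization.realizes_zero W W) hδ (biprod.fst ≫ f)
    (0 : W ⟶ Z) (by simp [hf])
  exact ⟨c, by rw [← hc]; simp⟩

lemma comp_eq_zero (hδ : Realizes s x y δ) : x ≫ y = 0 := by
  obtain ⟨b, hb, hb'⟩ := h.realization.exists_mid (h.realization.realizes_zero X X) hδ (𝟙 X)
    (0 : X ⟶ Z) (by rw [push_zero, h.pull_zero_left])
  rw [← Category.id_comp x, ← hb, Category.assoc, ← hb']
  simp

lemma push_fst (hδ : Realizes s x y δ) : push E x δ = 0 := by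
  obtain ⟨c, hc, -⟩ := h.et3 hδ (h.realization.realizes_zero Y Z) x (biprod.lift (𝟙 Y) 0)
    (by ext <;> simp)
  rw [hc, pull_zero]

lemma pull_snd (hδ : Realizes s x y δ) : pull E y δ = 0 := by
  obtain ⟨c, hc, -⟩ := h.et3_op (h.realization.realizes_zero X Y) hδ (biprod.desc 0 (𝟙 Y)) y
    (by ext <;> simp)
  rw [← hc, push_zero]

/-- Exactness at `𝔼(Z, W)`. -/
lemma exists_push_eq (hδ : Realizes s x y δ) {W : C} (ε : Ext E Z W) (hε : pull E y ε = 0) :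
    ∃ a : X ⟶ W, push E a δ = ε := by
  obtain ⟨V, x', y', hV⟩ := exists_realizes s ε
  obtain ⟨b, hb⟩ := h.exists_lift hV y hε
  obtain ⟨a, ha, -⟩ := h.et3_op hδ hV b (𝟙 Z) (by simp [hb])
  exact ⟨a, by rw [ha, pull_id]⟩

/-- An endomorphism of the middle term which is compatible with the identities of the ends is
invertible. -/
lemma isIso_of_endo (hδ : Realizes s x y δ) (f : Y ⟶ Y) (hx : x ≫ f = x) (hy : f ≫ y = y) :
    IsIso f := by
  obtain ⟨a, ha⟩ := h.exists_factor hδ (f - 𝟙 Y) (by simp [hy])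
  -- Since `f - 𝟙` factors through `x` and `x` is fixed by `f`, it squares to zero; the inverse of
  -- `f` is therefore `2 - f`.
  have hsq : (f - 𝟙 Y) ≫ (f - 𝟙 Y) = 0 := by
    rw [← ha, Category.assoc, ha]; simp [hx]
  have hff : f ≫ f = f + f - 𝟙 Y := by
    simp only [Preadditive.comp_sub, Preadditive.sub_comp, Category.comp_id, Category.id_comp]
      at hsq
    rw [← sub_eq_zero, ← hsq]; abel
  exact ⟨⟨𝟙 Y + 𝟙 Y - f, by simp [hff], by simp [hff]⟩⟩

/-- The five lemma for morphisms of extensions. -/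
lemma isIso_mid {Y' Z' : C} {x' : X ⟶ Y'} {y' : Y' ⟶ Z'} {δ' : Ext E Z' X}
    (hδ : Realizes s x y δ) (hδ' : Realizes s x' y' δ') (f : Y ⟶ Y') (c : Z ⟶ Z')
    (hx : x ≫ f = x') (hy : y ≫ c = f ≫ y') (hc : δ = pull E c δ') [IsIso c] : IsIso f := by
  obtain ⟨g, hg, hg'⟩ := h.realization.exists_mid hδ' hδ (𝟙 X) (inv c)
    (by rw [hc, ← pull_comp, IsIso.inv_hom_id, pull_id, push_id])
  rw [Category.id_comp] at hg
  have h₁ : IsIso (f ≫ g) := h.isIso_of_endo hδ _ (by rw [← Category.assoc, hx, hg])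
    (by rw [Category.assoc, ← hg', ← Category.assoc, ← hy]; simp)
  have h₂ : IsIso (g ≫ f) := h.isIso_of_endo hδ' _ (by rw [← Category.assoc, hg, hx])
    (by rw [Category.assoc, ← hy, ← Category.assoc, ← hg']; simp)
  have : IsSplitEpi f := IsSplitEpi.mk' ⟨inv (g ≫ f) ≫ g, by simp⟩
  have : Mono f := mono_of_mono f g
  exact isIso_of_mono_of_isSplitEpi f

/-- If a deflation becomes invertible on a subobject then the subobject is an inflation whose cone
is the cocone of the deflation. -/
lemma isConflation_of_isIso_comp (hδ : Realizes s x y δ) {S : C} (t : S ⟶ Y) [IsIso (t ≫ y)] :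
    ∃ v : Y ⟶ X, IsConflation s t v := by
  have h0 : δ = 0 := by
    have : δ = pull E (inv (t ≫ y) ≫ t) (pull E y δ) := by
      rw [← pull_comp]; simp [pull_id]
    rw [this, h.pull_snd hδ, pull_zero]
  subst h0
  obtain ⟨r, hr⟩ := h.exists_extend hδ (𝟙 X) (push_zero _)
  -- `y ≫ inv (t ≫ y) ≫ t` is the projection onto `S`; the complementary projection factors through
  -- `x`, and `q` is its component on `X`.
  obtain ⟨q, hq⟩ := h.exists_factor hδ (𝟙 Y - y ≫ inv (t ≫ y) ≫ t) (by simp)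
  have hxy := h.comp_eq_zero hδ
  have htq : t ≫ q = 0 := by
    have : (t ≫ q) ≫ x = 0 := by
      rw [Category.assoc, hq, Preadditive.comp_sub, ← Category.assoc t y]; simp
    rw [← Category.comp_id (t ≫ q), ← hr, ← Category.assoc, this, zero_comp]
  have hxq : x ≫ q = 𝟙 X := by
    have : (x ≫ q) ≫ x = x := by
      rw [Category.assoc, hq, Preadditive.comp_sub, ← Category.assoc x y, hxy]; simp
    rw [← Category.comp_id (x ≫ q), ← hr, ← Category.assoc, this]
  refine ⟨q, 0, (h.realization.realizes_zero S X).of_iso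
    ⟨biprod.desc t x, biprod.lift (y ≫ inv (t ≫ y)) q, ?_, ?_⟩ (by simp) ?_⟩
  · ext
    · simp [← Category.assoc t y]
    · simp [htq]
    · simp [reassoc_of% hxy]
    · simp [hxq]
  · simp [hq]
  · ext <;> simp [htq, hxq]

/-- Isomorphisms are deflations with zero cocones. -/
lemma isConflation_of_isZero {O M S : C} (hO : IsZero O) (f : O ⟶ M) (g : M ⟶ S) [IsIso g] :
    IsConflation s f g := by
  refine ⟨0, (h.realization.realizes_zero O S).of_iso ⟨biprod.snd ≫ inv g, g ≫ biprod.inr,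
    ?_, ?_⟩ (hO.eq_of_src _ _) (by simp)⟩
  · ext
    · exact hO.eq_of_src _ _
    · exact hO.eq_of_src _ _
    · exact hO.eq_of_tgt _ _
    · simp
  · simp

end IsExtriangulated

end Exactness

/-! ### Filtrations and length -/

section Filtrations

variable {C : Type u} [Category.{v} C] {E : Cᵒᵖ ⥤ C ⥤ AddCommGrpCat.{w}}
  {s : Correspondence E} {𝒳 : Set (IsoClasses C)}

/-- The minimal length of an `𝒳`-filtration of an object (zero if there is none). -/
noncomputable def len (s : Correspondence E) (𝒳 : Set (IsoClasses C)) (M : C) : ℕ :=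
  sInf {n | HasFiltration s 𝒳 n M}

lemma HasFiltration.of_iso {n : ℕ} {M N : C} (hM : HasFiltration s 𝒳 n M) (b : M ≅ N) :
    HasFiltration s 𝒳 n N := by
  cases hM with
  | zero h => exact .zero (h.of_iso b.symm)
  | succ f g h₁ h₂ h₃ =>
    obtain ⟨δ, hδ⟩ := h₂
    exact .succ (f ≫ b.hom) (b.inv ≫ g) h₁ ⟨δ, hδ.of_iso b rfl (by simp)⟩ h₃

lemma HasFiltration.isZero {M : C} (hM : HasFiltration s 𝒳 0 M) : IsZero M := by
  cases hM with
  | zero h => exact h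

lemma HasFiltration.filt {n : ℕ} {M : C} (hM : HasFiltration s 𝒳 n M) : Filt s 𝒳 M := ⟨n, hM⟩

lemma HasFiltration.len_le {n : ℕ} {M : C} (hM : HasFiltration s 𝒳 n M) : len s 𝒳 M ≤ n :=
  Nat.sInf_le hM

lemma hasFiltration_len {M : C} (hM : Filt s 𝒳 M) : HasFiltration s 𝒳 (len s 𝒳 M) M :=
  Nat.sInf_mem (s := {n | HasFiltration s 𝒳 n M}) hM

lemma len_eq_of_iso {M N : C} (b : M ≅ N) : len s 𝒳 M = len s 𝒳 N := by
  unfold len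
  congr 1
  ext n
  exact ⟨fun h => h.of_iso b, fun h => h.of_iso b.symm⟩

lemma isZero_of_len_eq_zero {M : C} (hM : Filt s 𝒳 M) (h : len s 𝒳 M = 0) : IsZero M :=
  (h ▸ hasFiltration_len hM : HasFiltration s 𝒳 0 M).isZero

lemma len_of_isZero {M : C} (hM : IsZero M) : len s 𝒳 M = 0 :=
  Nat.le_zero.1 (HasFiltration.zero hM).len_le

lemma isoClass_mem_of_iso {M N : C} (b : M ≅ N) (hM : isoClass M ∈ 𝒳) : isoClass N ∈ 𝒳 := by
  have : isoClass M = isoClass N := Quotient.sound ⟨b⟩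
  rwa [← this]

end Filtrations

/-! ### Socle-injective morphisms and length -/

section Socle

variable {C : Type u} [Category.{v} C] [Preadditive C] [HasZeroObject C] [HasBinaryBiproducts C]
  {E : Cᵒᵖ ⥤ C ⥤ AddCommGrpCat.{w}} {s : Correspondence E} {𝒳 : Set (IsoClasses C)}

omit [HasZeroObject C] [HasBinaryBiproducts C] in
lemma IsSemibrick.isIso (h𝒳 : IsSemibrick 𝒳) {X Y : C} (hX : isoClass X ∈ 𝒳)
    (hY : isoClass Y ∈ 𝒳) (f : X ⟶ Y) (hf : f ≠ 0) : IsIso f := by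
  have : Nonempty (X ≅ Y) := by
    by_contra hXY
    exact hf (h𝒳.hom_eq_zero X Y hX hY (not_nonempty_iff.1 hXY) f)
  obtain ⟨b⟩ := this
  have h0 : (f ≫ b.inv : End X) ≠ 0 := fun h0 => hf (by
    rw [← Category.comp_id f, ← b.inv_hom_id, ← Category.assoc]
    exact (congrArg (· ≫ b.hom) h0).trans zero_comp)
  have := (isUnit_iff_isIso (f ≫ b.inv : End X)).1 ((h𝒳.brick X hX).2 _ h0)
  have : IsIso ((f ≫ b.inv) ≫ b.hom) := by
    have : IsIso (f ≫ b.inv) := this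
    infer_instance
  simpa using this

/-- A morphism is socle-injective if no nonzero morphism from a member of `𝒳` is annihilated. -/
def SocInj (𝒳 : Set (IsoClasses C)) {M N : C} (f : M ⟶ N) : Prop :=
  ∀ (X : C) (u : X ⟶ M), isoClass X ∈ 𝒳 → u ≫ f = 0 → u = 0

omit [HasZeroObject C] [HasBinaryBiproducts C] in
lemma socInj_of_mono {M N : C} (f : M ⟶ N) [Mono f] : SocInj 𝒳 f :=
  fun _ _ _ hu => zero_of_comp_mono f hu

namespace IsExtriangulated

variable (h : IsExtriangulated E s) (h𝒳 : IsSemibrick 𝒳)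

include h

open scoped ZeroObject in
lemma hasFiltration_one {X M : C} (hX : isoClass X ∈ 𝒳) (f : X ⟶ M) [IsIso f] :
    HasFiltration s 𝒳 1 M :=
  .succ (0 : 0 ⟶ M) (inv f) (.zero (isZero_zero C))
    (h.isConflation_of_isZero (isZero_zero C) _ _) hX

omit [HasZeroObject C] in
/-- `Filt(𝒳)` is closed under extensions. -/
lemma hasFiltration_add {m n : ℕ} {K : C} (hK : HasFiltration s 𝒳 n K) : ∀ {A M : C}
    (u : A ⟶ M) (v : M ⟶ K), IsConflation s u v → HasFiltration s 𝒳 m A →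
    HasFiltration s 𝒳 (m + n) M := by
  induction hK with
  | @zero K hK =>
    rintro A M u v ⟨δ, hδ⟩ hA
    obtain ⟨r, hr⟩ := h.exists_extend hδ (𝟙 A) (by
      have : δ = pull E (0 : K ⟶ K) δ := by rw [← hK.eq_of_src (𝟙 K) 0, pull_id]
      rw [this, h.pull_zero_left, push_zero])
    refine hA.of_iso ⟨u, r, hr, ?_⟩
    obtain ⟨g, hg⟩ := h.exists_desc hδ (r ≫ u - 𝟙 M) (by simp [reassoc_of% hr])
    rw [hK.eq_of_src g 0, comp_zero] at hg
    exact (sub_eq_zero.1 hg.symm)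
  | @succ n K' K S f g _ hfg hS ih =>
    rintro A M u v ⟨δ, hδ⟩ hA
    obtain ⟨δ', hδ'⟩ := hfg
    obtain ⟨L, h', d, e, δ'', -, -, h₁, h₂, -, -⟩ := h.et4_op hδ hδ'
    exact .succ h' (v ≫ g) (ih d e ⟨_, h₂⟩ hA) ⟨_, h₁⟩ hS

omit [HasZeroObject C] in
lemma filt_of_realizes {A M K : C} {u : A ⟶ M} {v : M ⟶ K} {δ : Ext E K A}
    (hδ : Realizes s u v δ) (hA : Filt s 𝒳 A) (hK : Filt s 𝒳 K) : Filt s 𝒳 M :=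
  (h.hasFiltration_add (hasFiltration_len hK) u v ⟨δ, hδ⟩ (hasFiltration_len hA)).filt

omit [HasZeroObject C] in
include h𝒳 in
/-- A nonzero morphism from a member of `𝒳` is an inflation whose cone has a shorter filtration. -/
lemma exists_cone {n : ℕ} {M : C} (hM : HasFiltration s 𝒳 n M) : ∀ {X : C} (u : X ⟶ M),
    isoClass X ∈ 𝒳 → u ≠ 0 → ∃ (m : ℕ) (K : C) (v : M ⟶ K), n = m + 1 ∧
      IsConflation s u v ∧ HasFiltration s 𝒳 m K := by
  induction hM with
  | zero hM => exact fun u _ hu => (hu (hM.eq_of_tgt _ _)).elim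
  | @succ n M N S f g hM hfg hS ih =>
    rintro X u hX hu
    obtain ⟨δ, hδ⟩ := hfg
    by_cases hug : u ≫ g = 0
    · obtain ⟨u', rfl⟩ := h.exists_factor hδ u hug
      obtain ⟨m, K, v, rfl, ⟨ε, hε⟩, hK⟩ := ih u' hX (by rintro rfl; simp at hu)
      obtain ⟨L, h', d, e, δ'', -, -, h₁, h₂, -, -⟩ := h.et4 hε hδ
      exact ⟨m + 1, L, h', rfl, ⟨_, h₁⟩, .succ d e hK ⟨_, h₂⟩ hS⟩
    -- By Schur's lemma `u` splits off the top factor `S`, so its cone is the previous term of the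
    -- filtration.
    · have := h𝒳.isIso hX hS _ hug
      obtain ⟨v, hv⟩ := h.isConflation_of_isIso_comp hδ u
      exact ⟨n, M, v, rfl, hv, hM⟩

include h𝒳 in
-- A shortest filtration of `M` yields a filtration of `K` with one step fewer; conversely, adding
-- `X` to a shortest filtration of `K` gives one of `M`.
lemma exists_cone_len {M : C} (hM : Filt s 𝒳 M) {X : C} (u : X ⟶ M) (hX : isoClass X ∈ 𝒳)
    (hu : u ≠ 0) : ∃ (K : C) (v : M ⟶ K) (δ : Ext E K X), Realizes s u v δ ∧ Filt s 𝒳 K ∧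
      len s 𝒳 M = len s 𝒳 K + 1 := by
  obtain ⟨m, K, v, hm, huv, hK⟩ := h.exists_cone h𝒳 (hasFiltration_len hM) u hX hu
  have h₁ := hK.len_le
  have h₂ := (h.hasFiltration_add (hasFiltration_len hK.filt) u v huv
    (h.hasFiltration_one hX (𝟙 X))).len_le
  obtain ⟨δ, hδ⟩ := huv
  exact ⟨K, v, δ, hδ, hK.filt, by omega⟩

omit [HasZeroObject C] in
/-- Objects of `Filt(𝒳)` are detected by morphisms from the members of `𝒳`. -/
lemma hom_eq_zero {W M : C} (hW : Filt s 𝒳 W)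
    (hM : ∀ (X : C) (u : X ⟶ M), isoClass X ∈ 𝒳 → u = 0) (f : W ⟶ M) : f = 0 := by
  obtain ⟨n, hn⟩ := hW
  induction hn with
  | zero hW => exact hW.eq_of_src _ _
  | succ i p _ hip hS ih =>
    obtain ⟨δ, hδ⟩ := hip
    obtain ⟨g, rfl⟩ := h.exists_desc hδ f (ih _)
    rw [hM _ g hS, comp_zero]

omit [HasZeroObject C] in
lemma exists_socle {M : C} (hM : Filt s 𝒳 M) (hM0 : ¬ IsZero M) :
    ∃ (X : C) (u : X ⟶ M), isoClass X ∈ 𝒳 ∧ u ≠ 0 := by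
  by_contra! hcon
  exact hM0 ((IsZero.iff_id_eq_zero M).2 (h.hom_eq_zero hM hcon (𝟙 M)))

include h𝒳 in
/-- A socle-injective morphism induces a socle-injective morphism between the cones of a morphism
from a member of `𝒳`. -/
lemma exists_socInj_cone {M N : C} (hM : Filt s 𝒳 M) (hN : Filt s 𝒳 N) (f : M ⟶ N)
    (hf : SocInj 𝒳 f) {X : C} (u : X ⟶ M) (hX : isoClass X ∈ 𝒳) (hu : u ≠ 0) :
    ∃ (K L : C) (v : M ⟶ K) (v' : N ⟶ L) (δ : Ext E K X) (δ' : Ext E L X) (k : K ⟶ L),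
      Realizes s u v δ ∧ Realizes s (u ≫ f) v' δ' ∧ Filt s 𝒳 K ∧ Filt s 𝒳 L ∧
      len s 𝒳 M = len s 𝒳 K + 1 ∧ len s 𝒳 N = len s 𝒳 L + 1 ∧
      δ = pull E k δ' ∧ v ≫ k = f ≫ v' ∧ SocInj 𝒳 k := by
  obtain ⟨K, v, δ, hδ, hK, hMK⟩ := h.exists_cone_len h𝒳 hM u hX hu
  obtain ⟨L, v', δ', hδ', hL, hNL⟩ := h.exists_cone_len h𝒳 hN (u ≫ f) hX
    (fun h0 => hu (hf X u hX h0))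
  obtain ⟨k, hk, hk'⟩ := h.et3 hδ hδ' (𝟙 X) f (by simp)
  rw [push_id] at hk
  refine ⟨K, L, v, v', δ, δ', k, hδ, hδ', hK, hL, hMK, hNL, hk, hk', ?_⟩
  intro S w hS hw
  -- Diagram chase: `w` kills the extension, so it lifts to `M`; there it differs from a multiple of
  -- `u` by a morphism killed by `f`, hence equals that multiple.
  obtain ⟨w', rfl⟩ := h.exists_lift hδ w (by rw [hk, ← pull_comp, hw, h.pull_zero_left])
  obtain ⟨t, ht⟩ := h.exists_factor hδ' (w' ≫ f) (by rw [Category.assoc, ← hk', ← hw]; simp)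
  have : w' - t ≫ u = 0 := hf S _ hS (by simp [← ht])
  rw [sub_eq_zero.1 this, Category.assoc, h.comp_eq_zero hδ, comp_zero]

include h𝒳 in
-- Dividing `M` and `N` by the same member of `𝒳` lowers both lengths by one and preserves
-- socle-injectivity, so induction applies. When lengths agree, the five lemma lifts the isomorphism
-- of the cones.
lemma len_le_and_isIso (n : ℕ) : ∀ {M N : C}, Filt s 𝒳 M → Filt s 𝒳 N → len s 𝒳 M = n →
    ∀ f : M ⟶ N, SocInj 𝒳 f → len s 𝒳 M ≤ len s 𝒳 N ∧ (len s 𝒳 M = len s 𝒳 N → IsIso f) := by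
  induction n with
  | zero =>
    intro M N hM hN hn f _
    refine ⟨by omega, fun hl => ?_⟩
    have hM' := isZero_of_len_eq_zero hM hn
    have hN' := isZero_of_len_eq_zero hN (hl ▸ hn)
    exact ⟨⟨0, hM'.eq_of_src _ _, hN'.eq_of_src _ _⟩⟩
  | succ n ih =>
    intro M N hM hN hn f hf
    obtain ⟨X, u, hX, hu⟩ := h.exists_socle hM (fun h0 => by
      rw [len_of_isZero h0] at hn; omega)
    obtain ⟨K, L, v, v', δ, δ', k, hδ, hδ', hK, hL, hMK, hNL, hk, hk', hkinj⟩ :=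
      h.exists_socInj_cone h𝒳 hM hN f hf u hX hu
    obtain ⟨h₁, h₂⟩ := ih hK hL (by omega) k hkinj
    refine ⟨by omega, fun hl => ?_⟩
    have := h₂ (by omega)
    exact h.isIso_mid hδ hδ' f k rfl hk' hk

include h𝒳 in
lemma len_le_of_socInj {M N : C} (hM : Filt s 𝒳 M) (hN : Filt s 𝒳 N) (f : M ⟶ N)
    (hf : SocInj 𝒳 f) : len s 𝒳 M ≤ len s 𝒳 N :=
  (h.len_le_and_isIso h𝒳 _ hM hN rfl f hf).1

include h𝒳 in
lemma isIso_of_socInj {M N : C} (hM : Filt s 𝒳 M) (hN : Filt s 𝒳 N) (f : M ⟶ N)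
    (hf : SocInj 𝒳 f) (hl : len s 𝒳 N ≤ len s 𝒳 M) : IsIso f :=
  (h.len_le_and_isIso h𝒳 _ hM hN rfl f hf).2
    (le_antisymm (h.len_le_of_socInj h𝒳 hM hN f hf) hl)

include h𝒳 in
/-- A morphism which is not socle-injective factors through a shorter object. -/
lemma exists_factor_of_not_socInj {M N : C} (hM : Filt s 𝒳 M) (f : M ⟶ N)
    (hf : ¬ SocInj 𝒳 f) : ∃ (K : C) (v : M ⟶ K) (g : K ⟶ N), Filt s 𝒳 K ∧
      len s 𝒳 M = len s 𝒳 K + 1 ∧ v ≫ g = f := by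
  unfold SocInj at hf
  push Not at hf
  obtain ⟨X, u, hX, huf, hu⟩ := hf
  obtain ⟨K, v, δ, hδ, hK, hMK⟩ := h.exists_cone_len h𝒳 hM u hX hu
  obtain ⟨g, hg⟩ := h.exists_desc hδ f huf
  exact ⟨K, v, g, hK, hMK, hg⟩

include h𝒳 in
/-- Morphisms to an injective object of `Filt(𝒳)` extend along socle-injective morphisms. -/
lemma exists_extend_of_socInj {I : C} (hI : ∀ Z : C, Filt s 𝒳 Z → ∀ ε : Ext E Z I, ε = 0)
    (n : ℕ) : ∀ {M N : C}, Filt s 𝒳 M → Filt s 𝒳 N → len s 𝒳 M = n → ∀ f : M ⟶ N,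
    SocInj 𝒳 f → ∀ g : M ⟶ I, ∃ g' : N ⟶ I, f ≫ g' = g := by
  induction n with
  | zero =>
    intro M N hM hN hn f _ g
    exact ⟨0, (isZero_of_len_eq_zero hM hn).eq_of_src _ _⟩
  | succ n ih =>
    intro M N hM hN hn f hf g
    obtain ⟨X, u, hX, hu⟩ := h.exists_socle hM (fun h0 => by
      rw [len_of_isZero h0] at hn; omega)
    obtain ⟨K, L, v, v', δ, δ', k, hδ, hδ', hK, hL, hMK, hNL, hk, hk', hkinj⟩ :=
      h.exists_socInj_cone h𝒳 hM hN f hf u hX hu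
    -- Injectivity of `I` extends `g` from `X` to all of `N`; the error `g - f ≫ p` vanishes on `X`,
    -- hence lives on the cones, where induction applies.
    obtain ⟨p, hp⟩ := h.exists_extend hδ' (u ≫ g) (hI L hL _)
    obtain ⟨q, hq⟩ := h.exists_desc hδ (g - f ≫ p) (by simp [← hp])
    obtain ⟨r, rfl⟩ := ih hK hL (by omega) k hkinj q
    refine ⟨p + v' ≫ r, ?_⟩
    rw [← Category.assoc, hk', Category.assoc] at hq
    rw [Preadditive.comp_add, hq]
    abel

include h𝒳 in
/-- `Filt(𝒳)` is idempotent complete. -/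
lemma exists_splitting {M : C} (hM : Filt s 𝒳 M) (e : M ⟶ M) (he : e ≫ e = e) :
    ∃ (Q : C) (p : M ⟶ Q) (i : Q ⟶ M), Filt s 𝒳 Q ∧ i ≫ p = 𝟙 Q ∧ p ≫ i = e := by
  classical
  -- Take a factorization of `e` through an object of least length. As `e = p ≫ (i ≫ p) ≫ i`,
  -- minimality forces `i ≫ p` to be socle-injective, hence invertible.
  let P : ℕ → Prop := fun r => ∃ (Q : C) (p : M ⟶ Q) (i : Q ⟶ M), Filt s 𝒳 Q ∧
    len s 𝒳 Q = r ∧ p ≫ i = e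
  have hP : ∃ r, P r := ⟨_, M, e, 𝟙 M, hM, rfl, by simp⟩
  obtain ⟨Q, p, i, hQ, hr, hpi⟩ := Nat.find_spec hP
  have hinj : SocInj 𝒳 (i ≫ p) := by
    by_contra hcon
    obtain ⟨K, a, b, hK, hQK, hab⟩ := h.exists_factor_of_not_socInj h𝒳 hQ _ hcon
    refine Nat.find_min hP (m := len s 𝒳 K) (by omega) ⟨K, p ≫ a, b ≫ i, hK, rfl, ?_⟩
    rw [← he, ← hpi]
    simp only [Category.assoc, reassoc_of% hab]
  have := h.isIso_of_socInj h𝒳 hQ hQ _ hinj le_rfl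
  have : Mono i := mono_of_mono i p
  have hepi : IsSplitEpi p := IsSplitEpi.mk' ⟨inv (i ≫ p) ≫ i, by simp⟩
  refine ⟨Q, p, i, hQ, ?_, hpi⟩
  rw [← cancel_mono i, ← cancel_epi p]
  simpa [hpi, reassoc_of% hpi] using he

end IsExtriangulated

end Socle

/-! ### Atoms and chains of non-isomorphisms -/

section Atoms

variable {C : Type u} [Category.{v} C] [Preadditive C]
  {E : Cᵒᵖ ⥤ C ⥤ AddCommGrpCat.{w}} {s : Correspondence E} {𝒳 : Set (IsoClasses C)}

/-- A nonzero object of `Filt(𝒳)` without nontrivial idempotent endomorphisms. -/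
structure IsAtom (s : Correspondence E) (𝒳 : Set (IsoClasses C)) (M : C) : Prop where
  filt : Filt s 𝒳 M
  not_isZero : ¬ IsZero M
  idem : ∀ e : M ⟶ M, e ≫ e = e → e = 0 ∨ e = 𝟙 M

lemma IsAtom.isIso_of_retract {M Q : C} (hM : IsAtom s 𝒳 M) (i : Q ⟶ M) (p : M ⟶ Q)
    (hip : i ≫ p = 𝟙 Q) (hQ : ¬ IsZero Q) : IsIso i ∧ IsIso p := by
  rcases hM.idem (p ≫ i) (by simp [reassoc_of% hip]) with h0 | h1
  · refine (hQ ((IsZero.iff_id_eq_zero Q).2 ?_)).elim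
    have : (i ≫ p) ≫ (i ≫ p) = i ≫ (p ≫ i) ≫ p := by simp
    simpa [hip, h0] using this
  · exact ⟨⟨p, hip, h1⟩, ⟨i, h1, hip⟩⟩

/-- `RadComp s 𝒳 k f`: the morphism `f` between atoms is the composite of `k` non-isomorphisms
between atoms, followed by an arbitrary morphism. -/
def RadComp (s : Correspondence E) (𝒳 : Set (IsoClasses C)) : ℕ → ∀ {M N : C}, (M ⟶ N) → Prop
  | 0, M, N, _ => IsAtom s 𝒳 M ∧ IsAtom s 𝒳 N
  | k + 1, M, N, f => IsAtom s 𝒳 M ∧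
      ∃ (L : C) (g : M ⟶ L) (h : L ⟶ N), ¬ IsIso g ∧ RadComp s 𝒳 k h ∧ g ≫ h = f

lemma RadComp.source {k : ℕ} {M N : C} {f : M ⟶ N} (hf : RadComp s 𝒳 k f) : IsAtom s 𝒳 M := by
  cases k with
  | zero => exact hf.1
  | succ k => exact hf.1

lemma RadComp.target {k : ℕ} : ∀ {M N : C} {f : M ⟶ N}, RadComp s 𝒳 k f → IsAtom s 𝒳 N := by
  induction k with
  | zero => exact fun hf => hf.2
  | succ k ih =>
    rintro M N f ⟨-, L, g, h, -, hh, -⟩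
    exact ih hh

lemma RadComp.cons {k : ℕ} {M L N : C} {g : M ⟶ L} {h : L ⟶ N} (hM : IsAtom s 𝒳 M)
    (hg : ¬ IsIso g) (hh : RadComp s 𝒳 k h) : RadComp s 𝒳 (k + 1) (g ≫ h) :=
  ⟨hM, L, g, h, hg, hh, rfl⟩

/-- Isolates one non-isomorphism in the middle of a chain, as the halving argument of Harada–Sai
needs. -/
lemma RadComp.exists_factor {b : ℕ} (a : ℕ) : ∀ {M N : C} {f : M ⟶ N},
    RadComp s 𝒳 (a + (b + 1)) f → ∃ (L L' : C) (f₁ : M ⟶ L) (g : L ⟶ L') (f₂ : L' ⟶ N),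
      RadComp s 𝒳 a f₁ ∧ ¬ IsIso g ∧ RadComp s 𝒳 b f₂ ∧ f = f₁ ≫ g ≫ f₂ := by
  induction a with
  | zero =>
    intro M N f hf
    rw [zero_add] at hf
    obtain ⟨hM, L, g, h, hg, hh, rfl⟩ := hf
    exact ⟨M, L, 𝟙 M, g, h, ⟨hM, hM⟩, hg, hh, by simp⟩
  | succ a ih =>
    intro M N f hf
    rw [show a + 1 + (b + 1) = a + (b + 1) + 1 by omega] at hf
    obtain ⟨hM, L, g, h, hg, hh, rfl⟩ := hf
    obtain ⟨L₁, L₂, f₁, g', f₂, h₁, h₂, h₃, rfl⟩ := ih hh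
    exact ⟨L₁, L₂, g ≫ f₁, g', f₂, .cons hM hg h₁, h₂, h₃, by simp⟩

end Atoms

/-! ### Harada–Sai lemma and almost split morphisms -/

section BoundedAtoms

variable {C : Type u} [Category.{v} C] [Preadditive C] [HasZeroObject C] [HasBinaryBiproducts C]
  {E : Cᵒᵖ ⥤ C ⥤ AddCommGrpCat.{w}} {s : Correspondence E} {𝒳 : Set (IsoClasses C)}

namespace IsExtriangulated

variable (h : IsExtriangulated E s) (h𝒳 : IsSemibrick 𝒳)

include h

lemma isAtom_of_mem (h𝒳 : IsSemibrick 𝒳) {X : C} (hX : isoClass X ∈ 𝒳) : IsAtom s 𝒳 X where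
  filt := (h.hasFiltration_one hX (𝟙 X)).filt
  not_isZero hX0 := by
    have := (h𝒳.brick X hX).1
    exact one_ne_zero (α := End X) (hX0.eq_of_src _ _)
  idem e he := by
    by_cases h0 : e = 0
    · exact .inl h0
    · have := h𝒳.isIso hX hX e h0
      exact .inr (by rw [← cancel_epi e, he, Category.comp_id])

include h𝒳

/-- Every object of `Filt(𝒳)` is a finite sum of atoms. -/
lemma exists_decomposition (n : ℕ) : ∀ {M : C}, Filt s 𝒳 M → len s 𝒳 M = n →
    ∃ (ι : Type) (_ : Fintype ι) (V : ι → C) (p : ∀ j, M ⟶ V j) (i : ∀ j, V j ⟶ M),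
      (∀ j, IsAtom s 𝒳 (V j)) ∧ ∑ j, p j ≫ i j = 𝟙 M := by
  induction n using Nat.strong_induction_on with
  | _ n ih =>
    intro M hM hn
    by_cases hM0 : IsZero M
    · exact ⟨Empty, inferInstance, Empty.elim, fun j => j.elim, fun j => j.elim, fun j => j.elim,
        hM0.eq_of_src _ _⟩
    by_cases hat : IsAtom s 𝒳 M
    · exact ⟨Unit, inferInstance, fun _ => M, fun _ => 𝟙 M, fun _ => 𝟙 M, fun _ => hat, by simp⟩
    obtain ⟨e, he, he0, he1⟩ : ∃ e : M ⟶ M, e ≫ e = e ∧ e ≠ 0 ∧ e ≠ 𝟙 M := by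
      by_contra! hcon
      exact hat ⟨hM, hM0, fun e he => or_iff_not_imp_left.2 (hcon e he)⟩
    have key : ∀ e : M ⟶ M, e ≫ e = e → e ≠ 𝟙 M →
        ∃ (ι : Type) (_ : Fintype ι) (V : ι → C) (p : ∀ j, M ⟶ V j) (i : ∀ j, V j ⟶ M),
          (∀ j, IsAtom s 𝒳 (V j)) ∧ ∑ j, p j ≫ i j = e := by
      intro e he he1
      obtain ⟨Q, p, i, hQ, hip, rfl⟩ := h.exists_splitting h𝒳 hM e he
      have : Mono i := mono_of_mono_fac hip
      have hle := h.len_le_of_socInj h𝒳 hQ hM i (socInj_of_mono i)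
      have hlt : len s 𝒳 Q < n := by
        by_contra hcon
        have := h.isIso_of_socInj h𝒳 hQ hM i (socInj_of_mono i) (by omega)
        apply he1
        rw [← cancel_epi i, reassoc_of% hip, Category.comp_id]
      obtain ⟨ι, hι, V, q, k, hV, hsum⟩ := ih _ hlt hQ rfl
      refine ⟨ι, hι, V, fun j => p ≫ q j, fun j => k j ≫ i, hV, ?_⟩
      calc ∑ j, (p ≫ q j) ≫ k j ≫ i = p ≫ (∑ j, q j ≫ k j) ≫ i := by
            simp [Preadditive.comp_sum, Preadditive.sum_comp]
        _ = p ≫ i := by rw [hsum, Category.id_comp]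
    obtain ⟨ι, hι, V, p, i, hV, hsum⟩ := key e he he1
    obtain ⟨κ, hκ, W, q, k, hW, hsum'⟩ := key (𝟙 M - e) (by simp [he]) (by simpa using he0)
    refine ⟨ι ⊕ κ, inferInstance, Sum.elim V W, Sum.rec p q, Sum.rec i k, ?_, ?_⟩
    · rintro (j | j)
      · exact hV j
      · exact hW j
    · rw [Fintype.sum_sum_type]
      exact (congrArg₂ (· + ·) hsum hsum').trans (by abel)

/-- A morphism through which the non-isomorphisms to atoms factor gives a finite family of
non-isomorphisms to atoms with the same property. -/
lemma exists_family_of_factor {M B : C} (hB : Filt s 𝒳 B) (x : M ⟶ B)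
    (hx : ∀ r : B ⟶ M, x ≫ r ≠ 𝟙 M)
    (hfac : ∀ N : C, IsAtom s 𝒳 N → ∀ a : M ⟶ N, ¬ IsIso a → ∃ b : B ⟶ N, x ≫ b = a) :
    ∃ (ι : Type) (_ : Fintype ι) (B : ι → C) (x : ∀ j, M ⟶ B j),
      (∀ j, IsAtom s 𝒳 (B j)) ∧ (∀ j, ¬ IsIso (x j)) ∧
      ∀ N : C, IsAtom s 𝒳 N → ∀ a : M ⟶ N, ¬ IsIso a → ∃ b : ∀ j, B j ⟶ N,
        ∑ j, x j ≫ b j = a := by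
  obtain ⟨ι, hι, V, p, i, hV, hsum⟩ := h.exists_decomposition h𝒳 _ hB rfl
  refine ⟨ι, hι, V, fun j => x ≫ p j, hV, fun j hj => ?_, fun N hN a ha => ?_⟩
  · exact hx (p j ≫ inv (x ≫ p j)) (by rw [← Category.assoc, IsIso.hom_inv_id])
  · obtain ⟨b, rfl⟩ := hfac N hN a ha
    refine ⟨fun j => i j ≫ b, ?_⟩
    calc ∑ j, (x ≫ p j) ≫ i j ≫ b = x ≫ (∑ j, p j ≫ i j) ≫ b := by
          simp [Preadditive.comp_sum, Preadditive.sum_comp]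
      _ = x ≫ b := by rw [hsum, Category.id_comp]

variable {n : ℕ} (hn : ∀ M : C, IsAtom s 𝒳 M → len s 𝒳 M ≤ n)

include hn

/-- The Harada–Sai lemma for atoms of bounded length. -/
lemma exists_factor_of_radComp (m : ℕ) : ∀ {M N : C} (f : M ⟶ N), RadComp s 𝒳 (2 ^ m - 1) f →
    ∃ (Q : C) (p : M ⟶ Q) (i : Q ⟶ N), Filt s 𝒳 Q ∧ len s 𝒳 Q ≤ n - m ∧ p ≫ i = f := by
  induction m with
  | zero => exact fun {M N} f hf => ⟨M, 𝟙 M, f, hf.1.filt, hn M hf.1, by simp⟩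
  | succ m ih =>
    intro M N f hf
    -- Two chains of `2 ^ m - 1` non-isomorphisms joined by one more, `g`.
    rw [show 2 ^ (m + 1) - 1 = (2 ^ m - 1) + ((2 ^ m - 1) + 1) by
      have := Nat.one_le_two_pow (n := m); rw [pow_succ]; omega] at hf
    obtain ⟨L, L', f₁, g, f₂, hf₁, hg, hf₂, rfl⟩ := hf.exists_factor
    obtain ⟨Q, p, i, hQ, hQl, rfl⟩ := ih f₁ hf₁
    obtain ⟨Q', p', i', hQ', hQl', rfl⟩ := ih f₂ hf₂
    by_cases h₁ : len s 𝒳 Q ≤ n - (m + 1)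
    · exact ⟨Q, p, i ≫ g ≫ p' ≫ i', hQ, h₁, by simp⟩
    by_cases h₂ : len s 𝒳 Q' ≤ n - (m + 1)
    · exact ⟨Q', p ≫ i ≫ g ≫ p', i', hQ', h₂, by simp⟩
    -- Now `Q` and `Q'` both have length exactly `n - m`, which is positive. If the middle morphism
    -- were socle-injective it would be invertible, making `Q` and `Q'` nonzero retracts of atoms
    -- and `g` an isomorphism.
    by_cases hinj : SocInj 𝒳 (i ≫ g ≫ p')
    · have := h.isIso_of_socInj h𝒳 hQ hQ' _ hinj (by omega)
      have hQ0 : ¬ IsZero Q := fun h0 => by rw [len_of_isZero h0] at h₁; omega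
      have hQ0' : ¬ IsZero Q' := fun h0 => by rw [len_of_isZero h0] at h₂; omega
      have hi := (hf₁.target.isIso_of_retract i ((g ≫ p') ≫ inv (i ≫ g ≫ p'))
        (by rw [← Category.assoc i, IsIso.hom_inv_id]) hQ0).1
      have hp := (hf₂.source.isIso_of_retract (inv (i ≫ g ≫ p') ≫ i ≫ g) p'
        (by rw [Category.assoc, Category.assoc, IsIso.inv_hom_id]) hQ0').2
      refine (hg ?_).elim
      have : g = inv i ≫ (i ≫ g ≫ p') ≫ inv p' := by simp
      rw [this]
      infer_instance
    · obtain ⟨K, v, g', hK, hQK, hvg⟩ := h.exists_factor_of_not_socInj h𝒳 hQ _ hinj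
      refine ⟨K, p ≫ v, g' ≫ i', hK, by omega, ?_⟩
      simp only [Category.assoc, reassoc_of% hvg]

lemma eq_zero_of_radComp {M N : C} (f : M ⟶ N) (hf : RadComp s 𝒳 (2 ^ n - 1) f) : f = 0 := by
  obtain ⟨Q, p, i, hQ, hQl, rfl⟩ := h.exists_factor_of_radComp h𝒳 hn n f hf
  have hQ0 := isZero_of_len_eq_zero hQ (by omega)
  rw [hQ0.eq_of_tgt p 0, zero_comp]

/-- Non-invertible endomorphisms of atoms are nilpotent. -/
lemma exists_radComp_endo {M : C} (hM : IsAtom s 𝒳 M) (f : End M)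
    (hf : ¬ IsIso (f : M ⟶ M)) : f ^ (2 ^ n - 1) = 0 := by
  apply h.eq_zero_of_radComp h𝒳 hn
  generalize 2 ^ n - 1 = k
  induction k with
  | zero => exact ⟨hM, hM⟩
  | succ k ih =>
    rw [pow_succ]
    exact .cons hM hf ih

/-- Endomorphism rings of atoms are local: a non-invertible `f` is nilpotent, so `1 - f` is a unit.
-/
lemma isIso_or_isIso {M : C} (hM : IsAtom s 𝒳 M) (f g : End M) (hfg : f + g = 1) :
    IsIso (f : M ⟶ M) ∨ IsIso (g : M ⟶ M) := by
  by_contra! hcon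
  have hnil : IsNilpotent f := ⟨_, h.exists_radComp_endo h𝒳 hn hM f hcon.1⟩
  have : IsUnit (1 - f) := hnil.isUnit_one_sub
  have hg : (1 - f) = g := by rw [sub_eq_iff_eq_add', hfg]
  rw [hg] at this
  exact hcon.2 ((isUnit_iff_isIso _).1 this)

/-- A non-injective atom is the start of an almost split extension. -/
lemma exists_almostSplit {M Z : C} (hZ : Filt s 𝒳 Z) (ε : Ext E Z M) (hε : ε ≠ 0) :
    ∃ (Z : C) (δ : Ext E Z M), IsAtom s 𝒳 Z ∧ δ ≠ 0 ∧
      ∀ W : C, IsAtom s 𝒳 W → ∀ r : W ⟶ Z, ¬ IsIso r → pull E r δ = 0 := by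
  obtain ⟨ι, hι, V, p, i, hV, hsum⟩ := h.exists_decomposition h𝒳 _ hZ rfl
  obtain ⟨j, hj⟩ : ∃ j, pull E (i j) ε ≠ 0 := by
    by_contra! hcon
    apply hε
    rw [← pull_id ε, ← hsum, h.pull_sum]
    exact Finset.sum_eq_zero fun j _ => by rw [pull_comp, hcon, pull_zero]
  by_contra! hcon
  -- Without an almost split extension, a nonzero pullback can always be continued along another
  -- non-isomorphism, against Harada–Sai.
  have chain : ∀ k : ℕ, ∃ (W : C) (g : W ⟶ V j), RadComp s 𝒳 k g ∧
      pull E g (pull E (i j) ε) ≠ 0 := by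
    intro k
    induction k with
    | zero => exact ⟨V j, 𝟙 _, ⟨hV j, hV j⟩, by rwa [pull_id]⟩
    | succ k ih =>
      obtain ⟨W, g, hg, hg0⟩ := ih
      obtain ⟨W', hW', r, hr, hr0⟩ := hcon W _ hg.source hg0
      exact ⟨W', r ≫ g, .cons hW' hr hg, by rwa [pull_comp]⟩
  obtain ⟨W, g, hg, hg0⟩ := chain (2 ^ n - 1)
  rw [h.eq_zero_of_radComp h𝒳 hn g hg] at hg0
  exact hg0 (h.pull_zero_left _)

/-- Existence of left almost split morphisms in `Filt(𝒳)`. -/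
lemma exists_leftAlmostSplit {M : C} (hM : IsAtom s 𝒳 M) :
    ∃ (ι : Type) (_ : Fintype ι) (B : ι → C) (x : ∀ j, M ⟶ B j),
      (∀ j, IsAtom s 𝒳 (B j)) ∧ (∀ j, ¬ IsIso (x j)) ∧
      ∀ N : C, IsAtom s 𝒳 N → ∀ a : M ⟶ N, ¬ IsIso a → ∃ b : ∀ j, B j ⟶ N,
        ∑ j, x j ≫ b j = a := by
  by_cases hinj : ∀ Z : C, Filt s 𝒳 Z → ∀ ε : Ext E Z M, ε = 0
  -- If `M` is injective in `Filt(𝒳)`, its socle is essentially simple, and the cone of any nonzero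
  -- `u₀` from `𝒳` is left almost split.
  · obtain ⟨X₀, u₀, hX₀, hu₀⟩ := h.exists_socle hM.filt hM.not_isZero
    obtain ⟨C₀, v₀, δ₀, hδ₀, hC₀, -⟩ := h.exists_cone_len h𝒳 hM.filt u₀ hX₀ hu₀
    have hv₀ : ∀ r : C₀ ⟶ M, ¬ IsIso (v₀ ≫ r) := by
      intro r hr
      apply hu₀
      rw [← cancel_mono (v₀ ≫ r), ← Category.assoc, h.comp_eq_zero hδ₀, zero_comp, zero_comp]
    refine h.exists_family_of_factor h𝒳 hC₀ v₀ (fun r hr => hv₀ r (hr ▸ inferInstance)) ?_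
    intro N hN a ha
    have ha' : ¬ SocInj 𝒳 a := by
      intro hinj'
      obtain ⟨r, hr⟩ := h.exists_extend_of_socInj h𝒳 hinj _ hM.filt hN.filt rfl a hinj' (𝟙 M)
      exact ha (hN.isIso_of_retract a r hr hM.not_isZero).1
    unfold SocInj at ha'
    push Not at ha'
    obtain ⟨X, u, hX, hua, hu⟩ := ha'
    obtain ⟨K, v, δ, hδ, hK, -⟩ := h.exists_cone_len h𝒳 hM.filt u hX hu
    -- Otherwise `(v₀, v)` is a split monomorphism, and locality makes `v₀` or `v` one too, although
    -- each kills a nonzero morphism. So some nonzero `t` factors through both `u₀` and `u`, and by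
    -- Schur `u₀` factors through `u`.
    have hnot : ¬ SocInj 𝒳 (biprod.lift v₀ v) := by
      intro hinj'
      obtain ⟨r, hr⟩ := h.exists_extend_of_socInj h𝒳 hinj _ hM.filt
        (h.filt_of_realizes (h.realization.realizes_zero C₀ K) hC₀ hK) rfl _ hinj' (𝟙 M)
      rcases h.isIso_or_isIso h𝒳 hn hM (v₀ ≫ biprod.inl ≫ r) (v ≫ biprod.inr ≫ r) (by
        rw [← Category.assoc v₀, ← Category.assoc v, ← Preadditive.add_comp, ← biprod.lift_eq]
        exact hr) with h' | h'
      · exact hv₀ _ h'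
      · apply hu
        rw [← cancel_mono (v ≫ biprod.inr ≫ r), ← Category.assoc, h.comp_eq_zero hδ, zero_comp,
          zero_comp]
    unfold SocInj at hnot
    push Not at hnot
    obtain ⟨S, t, hS, ht, ht0⟩ := hnot
    obtain ⟨p, rfl⟩ := h.exists_factor hδ₀ t
      (by simpa using congrArg (· ≫ biprod.fst) ht)
    obtain ⟨q, hq⟩ := h.exists_factor hδ (p ≫ u₀)
      (by simpa using congrArg (· ≫ biprod.snd) ht)
    have := h𝒳.isIso hS hX₀ p (by rintro rfl; simp at ht0)
    refine h.exists_desc hδ₀ a ?_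
    rw [← cancel_epi p, ← Category.assoc, ← hq, Category.assoc, hua, comp_zero, comp_zero]
  · push Not at hinj
    obtain ⟨Z, hZ, ε, hε⟩ := hinj
    obtain ⟨Z, δ, hZ, hδ0, hδr⟩ := h.exists_almostSplit h𝒳 hn hZ ε hε
    obtain ⟨B, x, y, hδ⟩ := exists_realizes s δ
    have hB := h.filt_of_realizes hδ hM.filt hZ.filt
    refine h.exists_family_of_factor h𝒳 hB x (fun r hr => hδ0 ?_) ?_
    · rw [← push_id δ, ← hr, push_comp, h.push_fst hδ, push_zero]
    intro N hN a ha
    refine h.exists_extend hδ a ?_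
    by_contra hε
    obtain ⟨V, x', y', hV⟩ := exists_realizes s (push E a δ)
    have hVF := h.filt_of_realizes hV hN.filt hZ.filt
    -- A component of `y'` from an atom cannot be invertible, since it would split the nonzero
    -- extension `a_* δ`; so `δ` dies along each of them.
    have hy' : pull E y' δ = 0 := by
      obtain ⟨ι, hι, W, p, i, hW, hsum⟩ := h.exists_decomposition h𝒳 _ hVF rfl
      rw [← Category.id_comp y', ← hsum, Preadditive.sum_comp, h.pull_sum]
      refine Finset.sum_eq_zero fun j _ => ?_
      rw [Category.assoc, pull_comp, hδr _ (hW j), pull_zero]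
      intro hj
      apply hε
      have : push E a δ = pull E (inv (i j ≫ y') ≫ i j) (pull E y' (push E a δ)) := by
        rw [← pull_comp]; simp
      rw [this, h.pull_snd hV, pull_zero]
    obtain ⟨b, hb⟩ := h.exists_push_eq hV δ hy'
    rw [← push_comp] at hb
    have hab : ¬ IsIso (a ≫ b) := fun hiso =>
      ha (hN.isIso_of_retract a (b ≫ inv (a ≫ b))
        (by rw [← Category.assoc, IsIso.hom_inv_id]) hM.not_isZero).1
    -- The nilpotent endomorphism `a ≫ b` fixes `δ`, so `δ = 0`.
    have hpow : ∀ k : ℕ, push E (End.of (a ≫ b) ^ k) δ = δ := by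
      intro k
      induction k with
      | zero => exact push_id δ
      | succ k ih =>
        rw [pow_succ]
        exact (push_comp (a ≫ b) (End.of (a ≫ b) ^ k) δ).trans (by rw [hb, ih])
    have := hpow (2 ^ n - 1)
    rw [h.exists_radComp_endo h𝒳 hn hM (a ≫ b) hab] at this
    exact hδ0 (this.symm.trans (h.push_zero_left δ))

end IsExtriangulated

end BoundedAtoms

/-! ### Atoms versus indecomposables of `Filt(𝒳)` -/

section Indecomposables

variable {C : Type u} [Category.{v} C] [Preadditive C]
  {E : Cᵒᵖ ⥤ C ⥤ AddCommGrpCat.{w}} {s : Correspondence E} {𝒳 : Set (IsoClasses C)}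

lemma isZero_fullSubcategory_iff (P : ObjectProperty C) (M : P.FullSubcategory) :
    IsZero M ↔ IsZero M.obj := by
  rw [IsZero.iff_id_eq_zero, IsZero.iff_id_eq_zero]
  exact ⟨fun h0 => congrArg (·.hom) h0, fun h0 => ObjectProperty.hom_ext _ h0⟩

/-- The projection onto `Y` is an idempotent of `M`: if it is `0` then `Y` vanishes, if it is the
identity then `Z` does. -/
lemma IsAtom.isIndecomposable {M : C} (hM : IsAtom s 𝒳 M) :
    IsIndecomposable (⟨M, hM.filt⟩ : (Filt s 𝒳).FullSubcategory) := by
  refine ⟨fun h0 => hM.not_isZero ((isZero_fullSubcategory_iff _ _).1 h0), ?_⟩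
  rintro Y Z b - ⟨φ⟩
  have hl : φ.inv.hom ≫ φ.hom.hom = 𝟙 b.pt.obj := congrArg (·.hom) φ.inv_hom_id
  have h₁ : b.inl.hom ≫ b.fst.hom = 𝟙 Y.obj := congrArg (·.hom) b.inl_fst
  have h₂ : b.inr.hom ≫ b.snd.hom = 𝟙 Z.obj := congrArg (·.hom) b.inr_snd
  have h₃ : b.inr.hom ≫ b.fst.hom = 0 := congrArg (·.hom) b.inr_fst
  rcases hM.idem (φ.hom.hom ≫ b.fst.hom ≫ b.inl.hom ≫ φ.inv.hom)
    (by simp [reassoc_of% hl, reassoc_of% h₁]) with h0 | h0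
  · left
    rw [isZero_fullSubcategory_iff, IsZero.iff_id_eq_zero]
    have := congrArg (fun f => (b.inl.hom ≫ φ.inv.hom) ≫ f ≫ φ.hom.hom ≫ b.fst.hom) h0
    simpa [reassoc_of% hl, reassoc_of% h₁, hl, h₁] using this
  · right
    rw [isZero_fullSubcategory_iff, IsZero.iff_id_eq_zero]
    have := congrArg (fun f => (b.inr.hom ≫ φ.inv.hom) ≫ f ≫ φ.hom.hom ≫ b.snd.hom) h0
    simpa [reassoc_of% hl, reassoc_of% h₃, hl, h₂] using this.symm

end Indecomposables

/-! ### Finiteness of the set of atoms -/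

section Finiteness

variable {C : Type u} [Category.{v} C] [Preadditive C] [HasZeroObject C] [HasBinaryBiproducts C]
  {E : Cᵒᵖ ⥤ C ⥤ AddCommGrpCat.{w}} {s : Correspondence E} {𝒳 : Set (IsoClasses C)}

namespace IsExtriangulated

variable (h : IsExtriangulated E s) (h𝒳 : IsSemibrick 𝒳)

include h h𝒳

/-- If the atoms have bounded length, then there are finitely many of them up to isomorphism. -/
lemma exists_finite_atoms (h𝒳fin : 𝒳.Finite) {n : ℕ}
    (hn : ∀ M : C, IsAtom s 𝒳 M → len s 𝒳 M ≤ n) :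
    ∃ T : Set C, T.Finite ∧ ∀ N : C, IsAtom s 𝒳 N → ∃ M ∈ T, Nonempty (M ≅ N) := by
  classical
  have step : ∀ M : C, ∃ B : Set C, B.Finite ∧ (IsAtom s 𝒳 M → ∀ N : C, IsAtom s 𝒳 N →
      ∀ a : M ⟶ N, ¬ IsIso a → a ∈ AddSubgroup.closure
        {f : M ⟶ N | ∃ (L : C) (g : M ⟶ L) (k : L ⟶ N), L ∈ B ∧ IsAtom s 𝒳 L ∧ ¬ IsIso g ∧
          g ≫ k = f}) := by
    intro M
    by_cases hM : IsAtom s 𝒳 M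
    · obtain ⟨ι, hι, B, x, hB, hx, hfac⟩ := h.exists_leftAlmostSplit h𝒳 hn hM
      refine ⟨Set.range B, Set.finite_range B, fun _ N hN a ha => ?_⟩
      obtain ⟨b, rfl⟩ := hfac N hN a ha
      exact AddSubgroup.sum_mem _ fun j _ =>
        AddSubgroup.subset_closure ⟨B j, x j, b j, ⟨j, rfl⟩, hB j, hx j, rfl⟩
    -- Non-atoms get the empty family, so that `B` can be chosen for every object.
    · exact ⟨∅, Set.finite_empty, fun hM' => (hM hM').elim⟩
  choose B hBfin hB using step
  -- `A k` is the set of objects reached from representatives of `𝒳` by `k` left almost split steps.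
  let A : ℕ → Set C := fun k => Nat.rec (Quotient.out '' 𝒳) (fun _ T => ⋃ M ∈ T, B M) k
  have hA : ∀ k, (A k).Finite := by
    intro k
    induction k with
    | zero => exact h𝒳fin.image _
    | succ k ih => exact ih.biUnion fun M _ => hBfin M
  refine ⟨⋃ k ∈ Finset.range (2 ^ n), A k, (Finset.range (2 ^ n)).finite_toSet.biUnion
    fun k _ => hA k, fun N hN => ?_⟩
  by_contra hcon
  have hnot : ∀ j < 2 ^ n, ∀ M ∈ A j, ¬ Nonempty (M ≅ N) := fun j hj M hM hiso =>
    hcon ⟨M, Set.mem_biUnion (Finset.mem_coe.2 (Finset.mem_range.2 hj)) hM, hiso⟩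
  -- No morphism from `A j` to `N` is invertible, so each can be expanded through level `j + 1`.
  -- Sums appear at every step, whence the generated subgroup.
  have key : ∀ k j : ℕ, k + j < 2 ^ n → ∀ M ∈ A j, IsAtom s 𝒳 M → ∀ f : M ⟶ N,
      f ∈ AddSubgroup.closure {g : M ⟶ N | RadComp s 𝒳 k g} := by
    intro k
    induction k with
    | zero => exact fun j _ M _ hM f => AddSubgroup.subset_closure ⟨hM, hN⟩
    | succ k ih =>
      intro j hj M hMA hM f
      refine (AddSubgroup.closure_le _).2 ?_ (hB M hM N hN f fun hf =>
        hnot j (by omega) M hMA ⟨asIso f⟩)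
      rintro _ ⟨L, g, l, hLB, hL, hg, rfl⟩
      have hl := ih (j + 1) (by omega) L (Set.mem_biUnion hMA hLB) hL l
      induction hl using AddSubgroup.closure_induction with
      | mem l hl => exact AddSubgroup.subset_closure (.cons hM hg hl)
      | zero => rw [comp_zero]; exact zero_mem _
      | add l l' _ _ h₁ h₂ => rw [Preadditive.comp_add]; exact add_mem h₁ h₂
      | neg l _ h₁ => rw [Preadditive.comp_neg]; exact neg_mem h₁
  obtain ⟨X, u, hX, hu⟩ := h.exists_socle hN.filt hN.not_isZero
  obtain ⟨b⟩ : Nonempty ((isoClass X).out ≅ X) :=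
    Quotient.exact (Quotient.out_eq (isoClass X))
  have hX' : isoClass (isoClass X).out ∈ 𝒳 := isoClass_mem_of_iso b.symm hX
  have hmem := key (2 ^ n - 1) 0 (by have := Nat.one_le_two_pow (n := n); omega) _
    ⟨_, hX, rfl⟩ (h.isAtom_of_mem h𝒳 hX') (b.hom ≫ u)
  have hzero : {g : (isoClass X).out ⟶ N | RadComp s 𝒳 (2 ^ n - 1) g} ⊆
      ((⊥ : AddSubgroup ((isoClass X).out ⟶ N)) : Set _) := fun g hg =>
    AddSubgroup.mem_bot.2 (h.eq_zero_of_radComp h𝒳 hn g hg)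
  have h0 := AddSubgroup.mem_bot.1 ((AddSubgroup.closure_le _).2 hzero hmem)
  apply hu
  rw [← cancel_epi b.hom, h0, comp_zero]

/-- The indecomposable objects of `Filt(𝒳)` are atoms. -/
lemma isAtom_of_isIndecomposable {M : (Filt s 𝒳).FullSubcategory} (hM : IsIndecomposable M) :
    IsAtom s 𝒳 M.obj where
  filt := M.property
  not_isZero h0 := hM.1 ((isZero_fullSubcategory_iff _ M).2 h0)
  idem e he := by
    obtain ⟨Q, p, i, hQ, hip, hpi⟩ := h.exists_splitting h𝒳 M.property e he
    obtain ⟨Q', p', i', hQ', hip', hpi'⟩ := h.exists_splitting h𝒳 M.property (𝟙 _ - e)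
      (by simp [he])
    have : Mono i := mono_of_mono_fac hip
    have : Mono i' := mono_of_mono_fac hip'
    have hz : i ≫ p' = 0 := by
      rw [← cancel_mono i', Category.assoc, hpi', ← hpi]; simp [reassoc_of% hip]
    have hz' : i' ≫ p = 0 := by
      rw [← cancel_mono i, Category.assoc, hpi, zero_comp, ← sub_sub_cancel (𝟙 _) e, ← hpi']
      simp [reassoc_of% hip']
    -- The images of `e` and `𝟙 - e` decompose `M`; one of them is zero.
    let b : BinaryBicone (C := (Filt s 𝒳).FullSubcategory) ⟨Q, hQ⟩ ⟨Q', hQ'⟩ :=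
      { pt := M
        fst := ObjectProperty.homMk p
        snd := ObjectProperty.homMk p'
        inl := ObjectProperty.homMk i
        inr := ObjectProperty.homMk i'
        inl_fst := ObjectProperty.hom_ext _ hip
        inl_snd := ObjectProperty.hom_ext _ hz
        inr_fst := ObjectProperty.hom_ext _ hz'
        inr_snd := ObjectProperty.hom_ext _ hip' }
    have hb : b.IsBilimit := isBinaryBilimitOfTotal b (ObjectProperty.hom_ext _ (by
      change p ≫ i + p' ≫ i' = 𝟙 M.obj
      rw [hpi, hpi']; abel))
    rcases hM.2 _ _ b ⟨hb⟩ ⟨Iso.refl _⟩ with h0 | h0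
    · have := (isZero_fullSubcategory_iff _ _).1 h0
      left
      rw [← hpi, this.eq_of_tgt p 0, zero_comp]
    · have := (isZero_fullSubcategory_iff _ _).1 h0
      right
      rw [this.eq_of_tgt p' 0, zero_comp] at hpi'
      exact (sub_eq_zero.1 hpi'.symm).symm

end IsExtriangulated

end Finiteness

end Extri

/-! ### The equivalence -/

theorem corollary4p6 {R : Type*} [CommRing R] {C : Type u} [Category.{v} C] [Preadditive C]
    [HasZeroObject C] [HasBinaryBiproducts C] [Linear R C] (hKS : Extri.IsKrullSchmidt C)
    (E : Cᵒᵖ ⥤ C ⥤ AddCommGrpCat.{w}) (s : Extri.Correspondence E)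
    (hext : Extri.IsExtriangulated E s) [Extri.LinearExt R E] (hfin : Extri.IsRFinite R E)
    (𝒳 : Set (Extri.IsoClasses C)) (h𝒳 : Extri.IsSemibrick 𝒳) (h𝒳fin : 𝒳.Finite) :
    (Extri.ind (Extri.Filt s 𝒳).FullSubcategory).Finite ↔
      BddAbove {n : ℕ | ∃ M : (Extri.Filt s 𝒳).FullSubcategory,
        Extri.IsIndecomposable M ∧ Extri.filtLength s 𝒳 M = n} := by
  constructor
  · intro hind
    refine ((hind.image fun q => Extri.filtLength s 𝒳 q.out).subset ?_).bddAbove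
    rintro _ ⟨M, hM, rfl⟩
    obtain ⟨b⟩ : Nonempty ((Extri.isoClass M).out ≅ M) :=
      Quotient.exact (Quotient.out_eq (Extri.isoClass M))
    exact ⟨Extri.isoClass M, ⟨M, hM, rfl⟩, Extri.len_eq_of_iso ((Extri.Filt s 𝒳).ι.mapIso b)⟩
  · rintro ⟨n, hn⟩
    obtain ⟨T, hT, hTN⟩ := hext.exists_finite_atoms h𝒳 h𝒳fin (n := n)
      fun M hM => hn ⟨⟨M, hM.filt⟩, hM.isIndecomposable, rfl⟩
    classical
    -- The class of a zero object is only a default value: each `M` used below is isomorphic to some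
    -- `N` in `Filt(𝒳)`.
    obtain ⟨O, hO⟩ := HasZeroObject.zero (C := C)
    refine (hT.image fun M => if hM : Extri.Filt s 𝒳 M then
      Extri.isoClass (⟨M, hM⟩ : (Extri.Filt s 𝒳).FullSubcategory) else
      Extri.isoClass ⟨O, 0, .zero hO⟩).subset ?_
    rintro _ ⟨N, hN, rfl⟩
    obtain ⟨M, hMT, ⟨b⟩⟩ := hTN N.obj (hext.isAtom_of_isIndecomposable h𝒳 hN)
    obtain ⟨k, hk⟩ := N.property
    refine ⟨M, hMT, ?_⟩
    have hM : Extri.Filt s 𝒳 M := ⟨k, hk.of_iso b.symm⟩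
    simp only [dif_pos hM]
    exact Quotient.sound ⟨(Extri.Filt s 𝒳).isoMk b⟩
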